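/- Let $\mathcal B$ be the set of Borel probability measures $\mu$ on $\mathbb C$ whose support is compact and non-polar. For $\mu\in\mathcal B$ let $(P_n)_{n\ge 0}$ be its orthonormal polynomials, i.e. the unique sequence, orthonormal in $L^2(\mu)$, with $P_n(z)=\gamma_n z^n+\text{(lower order terms)}$ and $\gamma_n>0$, and let $\mathcal B_+=\{\mu\in\mathcal B : \limsup_{n\to\infty}\gamma_n^{1/n}<\infty\}$. For $n\ge 2$ let $\Omega_n=\{z\in\mathbb C : P_n^{k}(z)\to\infty \text{ as } k\to\infty\}$ be the basin of attraction of $\infty$ for $P_n$, where $P_n^k$ denotes the $k$-fold iterate, and let $g_n:\mathbb C\to[0,\infty)$ be the Green's function of $\Omega_n$ with pole at infinity. That is, $g_n$ is the unique non-negative subharmonic function on $\mathbb C$ that is harmonic and positive on $\Omega_n$, vanishes precisely at the points of $\mathbb C\setminus\Omega_n$ that are not Dirichlet irregular boundary points of $\Omega_n$, and satisfies $g_n(z)=\log|z|+O(1)$ as $z\to\infty$. Let $\mu\in\mathcal B_+$. Then there exist $N\in\mathbb N$ and $M>0$ such that for every $n\ge N$ the Green's function $g_n$ exists and $$\sup_{z\in\mathbb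 C}\Bigl|\,g_n(z)-\frac1n\log^+|P_n(z)|\,\Bigr|\le\frac Mn .$$ -/

import Mathlib

open scoped ENNReal Topology

namespace OrthoJulia

noncomputable section

/-- The logarithmic energy `∬ log |z - w| dν(z) dν(w)`, with `log 0 = -∞`, as positive part minus
negative part of the integral. (For a finite compactly supported `ν` the positive part is finite,
so that the value is a real number or `-∞`.) -/
def logEnergy (ν : MeasureTheory.Measure ℂ) : EReal :=
  ((∫⁻ z, ∫⁻ w, (ENNReal.log (edist z w)).toENNReal ∂ν ∂ν : ℝ≥0∞) : EReal)
    - ((∫⁻ z, ∫⁻ w, (-ENNReal.log (edist z w)).toENNReal ∂ν ∂ν : ℝ≥0∞) : EReal)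

/-- A set is polar if every nonzero finite Borel measure with compact support contained in it
has logarithmic energy `-∞`. -/
def IsPolar (E : Set ℂ) : Prop :=
  ∀ ν : MeasureTheory.Measure ℂ, MeasureTheory.IsFiniteMeasure ν → ν ≠ 0 →
    IsCompact ν.support → ν.support ⊆ E → logEnergy ν = ⊥

/-- The class `𝓑`: Borel probability measures on `ℂ` with compact non-polar support. -/
structure ClassB (μ : MeasureTheory.Measure ℂ) : Prop where
  isProbabilityMeasure : MeasureTheory.IsProbabilityMeasure μ
  isCompact_support : IsCompact μ.support
  not_isPolar_support : ¬ IsPolar μ.support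

/-- `P` is the sequence of orthonormal polynomials of `μ`: `P n` has degree `n` and positive
leading coefficient, and the sequence is orthonormal in `L²(μ)`. These conditions determine `P`. -/
structure IsOrthonormalPolynomials (μ : MeasureTheory.Measure ℂ) (P : ℕ → Polynomial ℂ) :
    Prop where
  natDegree_eq : ∀ n, (P n).natDegree = n
  leadingCoeff_im : ∀ n, (P n).leadingCoeff.im = 0
  leadingCoeff_re_pos : ∀ n, 0 < (P n).leadingCoeff.re
  orthonormal : ∀ m n,
    ∫ z, (P m).eval z * starRingEnd ℂ ((P n).eval z) ∂μ = if m = n then 1 else 0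

/-- The class `𝓑₊`: measures in `𝓑` whose orthonormal polynomials, with leading coefficients `γ_n`,
satisfy `limsup γ_n ^ (1 / n) < ∞`. -/
def ClassBPlus (μ : MeasureTheory.Measure ℂ) : Prop :=
  ClassB μ ∧ ∃ P : ℕ → Polynomial ℂ, IsOrthonormalPolynomials μ P ∧
    Filter.limsup
      (fun n : ℕ => ENNReal.ofReal ((P n).leadingCoeff.re ^ ((1 : ℝ) / (n : ℝ)))) Filter.atTop < ⊤

/-- The basin of attraction of `∞` of a polynomial: points whose forward orbit tends to `∞`. -/
def basinOfInfinity (P : Polynomial ℂ) : Set ℂ :=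
  {z | Filter.Tendsto (fun k : ℕ => (fun w : ℂ => P.eval w)^[k] z) Filter.atTop
    (Bornology.cobounded ℂ)}

/-- A real-valued function is subharmonic on the open set `U`: it is upper semicontinuous there and
satisfies the local submean inequality. -/
def SubharmonicOn (u : ℂ → ℝ) (U : Set ℂ) : Prop :=
  UpperSemicontinuousOn u U ∧
    ∀ c ∈ U, ∃ ρ > 0, ∀ r, 0 < r → r < ρ →
      CircleIntegrable u c r ∧ u c ≤ Real.circleAverage u c r

/-- `ζ` is a Dirichlet regular boundary point of the open set `D`: there is a barrier at `ζ`, i.e. a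
negative subharmonic function on the trace on `D` of a neighbourhood of `ζ`, which tends to `0`
at `ζ`. (Real values are no restriction: replace a barrier `b` by `max b (-1)`.) -/
def IsRegularBoundaryPoint (D : Set ℂ) (ζ : ℂ) : Prop :=
  ζ ∈ frontier D ∧ ∃ (V : Set ℂ) (b : ℂ → ℝ), IsOpen V ∧ ζ ∈ V ∧
    SubharmonicOn b (D ∩ V) ∧ (∀ z ∈ D ∩ V, b z < 0) ∧ Filter.Tendsto b (𝓝[D ∩ V] ζ) (𝓝 0)

/-- `g` is the Green's function, with pole at infinity, of the open set `D` with bounded complement,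
extended to the whole plane: a nonnegative subharmonic function on `ℂ`, harmonic and positive
on `D`, which vanishes precisely at the points of the complement of `D` other than the irregular
boundary points, and which is `log |z| + O(1)` at infinity. -/
structure IsGreenFunction (D : Set ℂ) (g : ℂ → ℝ) : Prop where
  nonneg : ∀ z, 0 ≤ g z
  subharmonic : SubharmonicOn g Set.univ
  harmonic : InnerProductSpace.HarmonicOnNhd g D
  pos : ∀ z ∈ D, 0 < g z
  eq_zero_iff : ∀ z, g z = 0 ↔ z ∈ Dᶜ \ {ζ ∈ frontier D | ¬ IsRegularBoundaryPoint D ζ}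
  log_asymptotics : (fun z => g z - Real.log ‖z‖) =O[Bornology.cobounded ℂ] (fun _ => (1 : ℝ))

end

end OrthoJulia

/-!
Write `d` for the degree of a polynomial `P` and suppose that `log⁺ ‖P‖` differs from `d log⁺ ‖·‖` by
at most `d M` on the whole plane. Then the functions `d⁻ᵏ log⁺ ‖P^k‖` form a uniform Cauchy sequence,
and their limit `g`, the escape rate, is continuous and satisfies `g ∘ P = d g` and
`|g - log⁺ ‖·‖| ≤ 2 M` (`exists_escapeRate`). Dividing the last bound, taken at `P z`, by `d` gives
`|g - d⁻¹ log⁺ ‖P‖| ≤ 2 M / d` (`greenFunction_basinOfInfinity`).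

The escape rate is the Green's function of the basin of infinity. The basin is `{g > 0}`, by the
functional equation. Near infinity `g - log ‖·‖` is the real part of the holomorphic series
`∑ d^(-k-1) (log ‖γ‖ + Log (P(w) / (γ w^d)))`, `w = P^k(z)`, where `γ` is the leading coefficient
of `P` (`exists_harmonicAt_escapeRate_of_lt`), and the functional equation carries harmonicity to
all of `{g > 0}`. Since `g` is continuous, `-g` is a barrier at each boundary point, so that all
of them are regular. Any other Green's function then vanishes off the basin too, is continuous, and
equals `g` by the maximum principle (`IsGreenFunction.unique`).

For orthonormal polynomials a common `M` serves all large `n`. If `μ` lives on the disc of radius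
`R`, then the zeros of `P n` lie in that disc (`norm_le_of_isRoot`), and the extremal property
`norm_coeff_sq_le`, applied to `z ^ n`, gives `γ_n ≥ R^(-n)`; the hypothesis on the `limsup` gives
`γ_n ≤ C ^ n` for large `n`. Hence `‖P_n(z)‖` lies between `((‖z‖ - R) / R) ^ n` (for `‖z‖ ≥ R`) and
`(C (‖z‖ + R)) ^ n` (`abs_posLog_norm_eval_sub_le`). Extremality also shows that the `γ_n` depend on
`μ` only, so that the `limsup` may be taken along any sequence of orthonormal polynomials.
-/

namespace OrthoJulia

open Filter MeasureTheory Polynomial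

/-! ### Orthonormal polynomials -/

section Orthonormal

variable {μ : Measure ℂ} {P : ℕ → ℂ[X]} {R : ℝ}

lemma integrable_of_continuous_of_ae_norm_le [IsFiniteMeasure μ] (hR : ∀ᵐ z ∂μ, ‖z‖ ≤ R)
    {f : ℂ → ℂ} (hf : Continuous f) : Integrable f μ := by
  obtain ⟨C, hC⟩ := (isCompact_closedBall (0 : ℂ) R).exists_bound_of_continuousOn hf.continuousOn
  refine Integrable.of_bound hf.aestronglyMeasurable C ?_
  filter_upwards [hR] with z hz using hC z (by simpa using hz)

/-- The Hermitian form of `L²(μ)` on polynomials, linear in the first argument. -/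
noncomputable def polyInner (μ : Measure ℂ) (p q : ℂ[X]) : ℂ :=
  ∫ z, p.eval z * starRingEnd ℂ (q.eval z) ∂μ

lemma polyInner_conj (p q : ℂ[X]) : starRingEnd ℂ (polyInner μ p q) = polyInner μ q p := by
  rw [polyInner, ← integral_conj]
  simp [polyInner, mul_comm]

lemma polyInner_self (p : ℂ[X]) : polyInner μ p p = ((∫ z, ‖p.eval z‖ ^ 2 ∂μ : ℝ) : ℂ) := by
  rw [polyInner, ← integral_complex_ofReal]
  simp [Complex.mul_conj']

lemma polyInner_C_mul_left (c : ℂ) (p q : ℂ[X]) :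
    polyInner μ (C c * p) q = c * polyInner μ p q := by
  simp [polyInner, mul_assoc, integral_const_mul]

lemma polyInner_add_left [IsFiniteMeasure μ] (hR : ∀ᵐ z ∂μ, ‖z‖ ≤ R) (p p' q : ℂ[X]) :
    polyInner μ (p + p') q = polyInner μ p q + polyInner μ p' q := by
  simp only [polyInner, eval_add, add_mul]
  exact integral_add
    (integrable_of_continuous_of_ae_norm_le hR
      (p.continuous.mul (Complex.continuous_conj.comp q.continuous)))
    (integrable_of_continuous_of_ae_norm_le hR
      (p'.continuous.mul (Complex.continuous_conj.comp q.continuous)))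

/-- Division of the top coefficient: a polynomial of degree at most `n` is a multiple of a given
one of degree `n`, up to lower order terms. -/
lemma exists_eq_C_mul_add_of_degree_lt {p Q : ℂ[X]} {n : ℕ} (hp : p.natDegree = n)
    (hp0 : p.leadingCoeff ≠ 0) (hQ : Q.degree < (n + 1 : ℕ)) :
    ∃ Q' : ℂ[X], Q = C (Q.coeff n / p.leadingCoeff) * p + Q' ∧ Q'.degree < (n : ℕ) := by
  refine ⟨Q - C (Q.coeff n / p.leadingCoeff) * p, by ring, ?_⟩
  rw [degree_lt_iff_coeff_zero]
  intro m hm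
  rw [coeff_sub, coeff_C_mul]
  rcases hm.eq_or_lt with rfl | hm
  · have : p.coeff n = p.leadingCoeff := by rw [leadingCoeff, hp]
    rw [this]
    field_simp
    ring
  · rw [(degree_lt_iff_coeff_zero _ _).1 hQ m hm, coeff_eq_zero_of_natDegree_lt (hp.trans_lt hm)]
    ring

namespace IsOrthonormalPolynomials

lemma leadingCoeff_eq_ofReal (hP : IsOrthonormalPolynomials μ P) (n : ℕ) :
    (P n).leadingCoeff = ((P n).leadingCoeff.re : ℂ) :=
  Complex.ext rfl (by simp [hP.leadingCoeff_im n])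

lemma leadingCoeff_ne_zero (hP : IsOrthonormalPolynomials μ P) (n : ℕ) :
    (P n).leadingCoeff ≠ 0 := fun h => by simpa [h] using hP.leadingCoeff_re_pos n

lemma norm_leadingCoeff (hP : IsOrthonormalPolynomials μ P) (n : ℕ) :
    ‖(P n).leadingCoeff‖ = (P n).leadingCoeff.re := by
  rw [hP.leadingCoeff_eq_ofReal n, Complex.norm_real, Complex.ofReal_re,
    Real.norm_of_nonneg (hP.leadingCoeff_re_pos n).le]

lemma polyInner_eq_zero_of_degree_lt [IsFiniteMeasure μ] (hP : IsOrthonormalPolynomials μ P)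
    (hR : ∀ᵐ z ∂μ, ‖z‖ ≤ R) {n : ℕ} {Q : ℂ[X]} (hQ : Q.degree < n) :
    polyInner μ Q (P n) = 0 := by
  have key : ∀ m ≤ n, ∀ Q : ℂ[X], Q.degree < m → polyInner μ Q (P n) = 0 := by
    intro m
    induction m with
    | zero =>
      intro _ Q hQ
      have : Q = 0 := by simpa using hQ
      simp [this, polyInner]
    | succ m ih =>
      intro hm Q hQ
      obtain ⟨Q', hQQ', hQ'⟩ := exists_eq_C_mul_add_of_degree_lt (hP.natDegree_eq m)
        (hP.leadingCoeff_ne_zero m) hQ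
      have hmn : polyInner μ (P m) (P n) = 0 := by
        rw [polyInner, hP.orthonormal, if_neg (by omega)]
      rw [hQQ', polyInner_add_left hR, polyInner_C_mul_left, hmn, ih (by omega) Q' hQ']
      ring
  exact key n le_rfl Q hQ

/-- The extremal property of orthonormal polynomials: among the polynomials of degree at most `n`,
`P n / γ_n` has the least `L²` norm for its coefficient of degree `n`. -/
lemma norm_coeff_sq_le [IsFiniteMeasure μ] (hP : IsOrthonormalPolynomials μ P)
    (hR : ∀ᵐ z ∂μ, ‖z‖ ≤ R) {n : ℕ} {Q : ℂ[X]} (hQ : Q.natDegree ≤ n) :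
    ‖Q.coeff n‖ ^ 2 ≤ (P n).leadingCoeff.re ^ 2 * ∫ z, ‖Q.eval z‖ ^ 2 ∂μ := by
  have hγ := hP.leadingCoeff_re_pos n
  obtain ⟨Q', hQQ', hQ'⟩ := exists_eq_C_mul_add_of_degree_lt (hP.natDegree_eq n)
    (hP.leadingCoeff_ne_zero n)
    ((degree_le_of_natDegree_le hQ).trans_lt (WithBot.coe_lt_coe.2 n.lt_succ_self))
  set c := Q.coeff n / (P n).leadingCoeff with hc
  have h0 : polyInner μ Q' (P n) = 0 := hP.polyInner_eq_zero_of_degree_lt hR hQ'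
  have h0' : polyInner μ (P n) Q' = 0 := by rw [← polyInner_conj, h0, map_zero]
  have h1 : polyInner μ (P n) (P n) = 1 := by rw [polyInner, hP.orthonormal, if_pos rfl]
  have h2 : polyInner μ (P n) Q = starRingEnd ℂ c := by
    rw [← polyInner_conj, hQQ', polyInner_add_left hR, polyInner_C_mul_left, h1, h0]
    simp
  have h3 : polyInner μ Q' Q = polyInner μ Q' Q' := by
    rw [← polyInner_conj, hQQ', polyInner_add_left hR, polyInner_C_mul_left, h0', mul_zero,
      zero_add, polyInner_conj]
  have h4 : polyInner μ Q Q = c * starRingEnd ℂ c + polyInner μ Q' Q' := by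
    calc polyInner μ Q Q = polyInner μ (C c * P n + Q') Q := by rw [← hQQ']
      _ = _ := by rw [polyInner_add_left hR, polyInner_C_mul_left, h2, h3]
  rw [polyInner_self, polyInner_self, Complex.mul_conj'] at h4
  have h5 : ∫ z, ‖Q.eval z‖ ^ 2 ∂μ = ‖c‖ ^ 2 + ∫ z, ‖Q'.eval z‖ ^ 2 ∂μ := by exact_mod_cast h4
  have h6 : 0 ≤ ∫ z, ‖Q'.eval z‖ ^ 2 ∂μ := by positivity
  have h7 : ‖Q.coeff n‖ = (P n).leadingCoeff.re * ‖c‖ := by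
    rw [hc, norm_div, hP.norm_leadingCoeff]
    field_simp
  rw [h7, mul_pow, h5]
  gcongr
  linarith

/-- The leading coefficients are determined by the measure, by extremality. -/
lemma leadingCoeff_re_le [IsFiniteMeasure μ] (hP : IsOrthonormalPolynomials μ P)
    {P' : ℕ → ℂ[X]} (hP' : IsOrthonormalPolynomials μ P') (hR : ∀ᵐ z ∂μ, ‖z‖ ≤ R) (n : ℕ) :
    (P' n).leadingCoeff.re ≤ (P n).leadingCoeff.re := by
  have h1 : ∫ z, ‖(P' n).eval z‖ ^ 2 ∂μ = 1 := by
    have h : polyInner μ (P' n) (P' n) = 1 := by rw [polyInner, hP'.orthonormal, if_pos rfl]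
    rw [polyInner_self] at h
    exact_mod_cast h
  have h2 := hP.norm_coeff_sq_le hR (hP'.natDegree_eq n).le
  rw [h1, mul_one] at h2
  have h3 : (P' n).coeff n = (P' n).leadingCoeff := by rw [leadingCoeff, hP'.natDegree_eq]
  rw [h3, hP'.norm_leadingCoeff] at h2
  exact le_of_sq_le_sq h2 (hP.leadingCoeff_re_pos n).le

/-- Extremality applied to the monomial `z ^ n`. -/
lemma one_le_leadingCoeff_mul_pow [IsProbabilityMeasure μ] (hP : IsOrthonormalPolynomials μ P)
    (hR0 : 0 ≤ R) (hR : ∀ᵐ z ∂μ, ‖z‖ ≤ R) (n : ℕ) : 1 ≤ (P n).leadingCoeff.re * R ^ n := by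
  have h1 := hP.norm_coeff_sq_le hR (n := n) (Q := X ^ n) (by simp)
  have h2 : ∫ z : ℂ, ‖(X ^ n : ℂ[X]).eval z‖ ^ 2 ∂μ ≤ (R ^ n) ^ 2 := by
    have : ∫ _ : ℂ, (R ^ n) ^ 2 ∂μ = (R ^ n) ^ 2 := by simp
    rw [← this]
    refine integral_mono_of_nonneg (.of_forall fun z => by positivity) (integrable_const _) ?_
    filter_upwards [hR] with z hz
    simp only [eval_pow, eval_X, norm_pow]
    gcongr
  have h3 : (1 : ℝ) ^ 2 ≤ ((P n).leadingCoeff.re * R ^ n) ^ 2 := by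
    rw [mul_pow]
    simp only [coeff_X_pow_self, norm_one] at h1
    exact h1.trans (by gcongr)
  exact le_of_sq_le_sq h3 (mul_nonneg (hP.leadingCoeff_re_pos n).le (by positivity))

/-- Fejér's argument: if `P n = (z - a) Q`, then `P n ⟂ Q` says that `a` is the mean of `z` with
respect to `‖Q‖² dμ`. -/
lemma norm_le_of_isRoot [IsFiniteMeasure μ] (hP : IsOrthonormalPolynomials μ P)
    (hR : ∀ᵐ z ∂μ, ‖z‖ ≤ R) {n : ℕ} {a : ℂ} (ha : (P n).IsRoot a) : ‖a‖ ≤ R := by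
  obtain ⟨Q, hQ⟩ := dvd_iff_isRoot.2 ha
  have hP0 : P n ≠ 0 := fun h => hP.leadingCoeff_ne_zero n (by simp [h])
  have hQ0 : Q ≠ 0 := by rintro rfl; exact hP0 (by simpa using hQ)
  have hdeg : n = Q.natDegree + 1 := by
    have := hP.natDegree_eq n
    rw [hQ, natDegree_mul (X_sub_C_ne_zero a) hQ0, natDegree_X_sub_C] at this
    omega
  have hperp : polyInner μ (P n) Q = 0 := by
    rw [← polyInner_conj, hP.polyInner_eq_zero_of_degree_lt hR, map_zero]
    rw [degree_eq_natDegree hQ0]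
    exact_mod_cast (by omega : Q.natDegree < n)
  have hpos : 0 < ∫ z, ‖Q.eval z‖ ^ 2 ∂μ := by
    have h1 := hP.norm_coeff_sq_le hR (le_refl Q.natDegree)
    have h2 : 0 < ‖Q.coeff Q.natDegree‖ ^ 2 := by
      have : Q.coeff Q.natDegree ≠ 0 := Polynomial.leadingCoeff_ne_zero.2 hQ0
      positivity
    exact pos_of_mul_pos_right (h2.trans_le h1) (by positivity)
  have hint : ∀ {f : ℂ → ℂ}, Continuous f → Integrable f μ :=
    integrable_of_continuous_of_ae_norm_le hR
  have hsq : Continuous fun z => (((‖Q.eval z‖ ^ 2 : ℝ)) : ℂ) :=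
    Complex.continuous_ofReal.comp (Q.continuous.norm.pow 2)
  have h1 : ∫ z, z * ((‖Q.eval z‖ ^ 2 : ℝ) : ℂ) ∂μ = a * ((∫ z, ‖Q.eval z‖ ^ 2 ∂μ : ℝ) : ℂ) := by
    have h2 : polyInner μ (P n) Q =
        ∫ z, (z * ((‖Q.eval z‖ ^ 2 : ℝ) : ℂ) - a * ((‖Q.eval z‖ ^ 2 : ℝ) : ℂ)) ∂μ := by
      rw [polyInner]
      congr 1 with z
      rw [hQ, eval_mul, mul_assoc, Complex.mul_conj']
      simp [sub_mul]
    rw [hperp, integral_sub (hint (by fun_prop)) (hint (by fun_prop)),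
      integral_const_mul, integral_complex_ofReal] at h2
    exact (sub_eq_zero.1 h2.symm)
  have h2 : ‖a‖ * ∫ z, ‖Q.eval z‖ ^ 2 ∂μ ≤ R * ∫ z, ‖Q.eval z‖ ^ 2 ∂μ := by
    calc ‖a‖ * ∫ z, ‖Q.eval z‖ ^ 2 ∂μ = ‖∫ z, z * ((‖Q.eval z‖ ^ 2 : ℝ) : ℂ) ∂μ‖ := by
          rw [h1, norm_mul, Complex.norm_real, Real.norm_of_nonneg hpos.le]
      _ ≤ ∫ z, R * ‖Q.eval z‖ ^ 2 ∂μ := by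
          refine norm_integral_le_of_norm_le ?_ ?_
          · have := (hint hsq).re.const_mul R
            simpa only [RCLike.re_to_complex, Complex.ofReal_re] using this
          · filter_upwards [hR] with z hz
            rw [norm_mul, Complex.norm_real, Real.norm_of_nonneg (by positivity)]
            gcongr
      _ = R * ∫ z, ‖Q.eval z‖ ^ 2 ∂μ := integral_const_mul _ _
  exact le_of_mul_le_mul_right h2 hpos

end IsOrthonormalPolynomials

end Orthonormal

/-! ### Comparison of `log⁺ ‖P_n‖` with `n log⁺ ‖·‖` -/

lemma norm_eval_eq_norm_leadingCoeff_mul_prod (p : ℂ[X]) (z : ℂ) :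
    ‖p.eval z‖ = ‖p.leadingCoeff‖ * (p.roots.map fun a => ‖z - a‖).prod := by
  have h := (IsAlgClosed.splits p).eval_eq_prod_roots z
  rw [h, norm_mul]
  congr 1
  generalize p.roots = s
  induction s using Multiset.induction_on with
  | empty => simp
  | cons a s ih => simp [ih]

lemma norm_eval_le_of_roots {p : ℂ[X]} {R : ℝ} (hp : ∀ a, p.IsRoot a → ‖a‖ ≤ R) (z : ℂ) :
    ‖p.eval z‖ ≤ ‖p.leadingCoeff‖ * (‖z‖ + R) ^ p.natDegree := by
  rw [norm_eval_eq_norm_leadingCoeff_mul_prod, ← IsAlgClosed.card_roots_eq_natDegree]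
  gcongr
  rw [← Multiset.prod_replicate, ← Multiset.map_const']
  refine Multiset.prod_map_le_prod_map₀ _ _ (fun a _ => norm_nonneg _) fun a ha => ?_
  exact (norm_sub_le _ _).trans (by gcongr; exact hp a (isRoot_of_mem_roots ha))

lemma le_norm_eval_of_roots {p : ℂ[X]} {R : ℝ} (hp : ∀ a, p.IsRoot a → ‖a‖ ≤ R) {z : ℂ}
    (hz : R ≤ ‖z‖) :
    ‖p.leadingCoeff‖ * (‖z‖ - R) ^ p.natDegree ≤ ‖p.eval z‖ := by
  rw [norm_eval_eq_norm_leadingCoeff_mul_prod, ← IsAlgClosed.card_roots_eq_natDegree]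
  gcongr
  rw [← Multiset.prod_replicate, ← Multiset.map_const']
  refine Multiset.prod_map_le_prod_map₀ _ _ (fun a _ => sub_nonneg.2 hz) fun a ha => ?_
  exact le_trans (by gcongr; exact hp a (isRoot_of_mem_roots ha)) (norm_sub_norm_le _ _)

/-- Zeros in a disc of radius `R` together with two-sided geometric bounds on the leading
coefficient control `log⁺ ‖p‖` at every point of the plane. -/
lemma abs_posLog_norm_eval_sub_le {p : ℂ[X]} {R C : ℝ} (hR : 0 < R)
    (hp : ∀ a, p.IsRoot a → ‖a‖ ≤ R) (hlow : 1 ≤ ‖p.leadingCoeff‖ * R ^ p.natDegree)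
    (hup : ‖p.leadingCoeff‖ ≤ C ^ p.natDegree) (z : ℂ) :
    |Real.posLog ‖p.eval z‖ - p.natDegree * Real.posLog ‖z‖| ≤
      p.natDegree * (Real.posLog C + Real.log 2 + Real.posLog R + Real.posLog (2 * R)) := by
  set n := p.natDegree
  have hC0 : 0 ≤ Real.posLog C := Real.posLog_nonneg
  have hR0 : 0 ≤ Real.posLog R := Real.posLog_nonneg
  have h2R0 : 0 ≤ Real.posLog (2 * R) := Real.posLog_nonneg
  have hlog2 : 0 ≤ Real.log 2 := Real.log_nonneg (by norm_num)
  have hn : (0 : ℝ) ≤ n := n.cast_nonneg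
  rw [abs_le]
  constructor
  · have key : n * Real.posLog ‖z‖ ≤ Real.posLog ‖p.eval z‖ + n * Real.posLog (2 * R) := by
      rcases le_total ‖z‖ (2 * R) with hz | hz
      · have h1 : n * Real.posLog ‖z‖ ≤ n * Real.posLog (2 * R) := by
          gcongr
        linarith [Real.posLog_nonneg (x := ‖p.eval z‖)]
      · have h1 : ‖z‖ ^ n ≤ ‖p.eval z‖ * (2 * R) ^ n := by
          calc ‖z‖ ^ n ≤ ‖z‖ ^ n * (‖p.leadingCoeff‖ * R ^ n) :=
                le_mul_of_one_le_right (by positivity) hlow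
            _ = ‖p.leadingCoeff‖ * (‖z‖ / 2) ^ n * (2 * R) ^ n := by
                rw [div_pow, mul_pow]; field_simp
            _ ≤ ‖p.leadingCoeff‖ * (‖z‖ - R) ^ n * (2 * R) ^ n := by
                gcongr
                linarith
            _ ≤ ‖p.eval z‖ * (2 * R) ^ n := by
                gcongr
                exact le_norm_eval_of_roots hp (by linarith)
        have h2 := (Real.posLog_le_posLog (by positivity) h1).trans Real.posLog_mul
        rwa [Real.posLog_pow, Real.posLog_pow] at h2
    have : 0 ≤ n * (Real.posLog C + Real.log 2 + Real.posLog R) := by positivity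
    linarith
  · have h1 : ‖p.eval z‖ ≤ (C * (‖z‖ + R)) ^ n := by
      rw [mul_pow]
      refine (norm_eval_le_of_roots hp z).trans ?_
      gcongr
    have h2 := Real.posLog_le_posLog (norm_nonneg _) h1
    rw [Real.posLog_pow] at h2
    have h3 : Real.posLog (C * (‖z‖ + R)) ≤
        Real.posLog C + (Real.log 2 + Real.posLog ‖z‖ + Real.posLog R) :=
      Real.posLog_mul.trans (by gcongr; exact Real.posLog_add)
    have h4 := mul_le_mul_of_nonneg_left h3 hn
    have h5 : 0 ≤ n * Real.posLog (2 * R) := by positivity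
    linarith

lemma eventually_le_pow_of_limsup_lt_top {γ : ℕ → ℝ} (hγ : ∀ n, 0 ≤ γ n)
    (h : limsup (fun n : ℕ => ENNReal.ofReal (γ n ^ ((1 : ℝ) / (n : ℝ)))) atTop < ⊤) :
    ∃ C : ℝ, ∀ᶠ n in atTop, γ n ≤ C ^ n := by
  obtain ⟨b, hb, hbt⟩ := exists_between h
  refine ⟨b.toReal, ?_⟩
  filter_upwards [eventually_lt_of_limsup_lt hb, eventually_ge_atTop 1] with n hn hn1
  have h1 : γ n ^ ((1 : ℝ) / (n : ℝ)) ≤ b.toReal := by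
    rw [← ENNReal.ofReal_le_iff_le_toReal hbt.ne]
    exact hn.le
  calc γ n = (γ n ^ ((1 : ℝ) / (n : ℝ))) ^ n := by
        rw [one_div, Real.rpow_inv_natCast_pow (hγ n) (by omega)]
    _ ≤ b.toReal ^ n := by
        have := Real.rpow_nonneg (hγ n) ((1 : ℝ) / (n : ℝ))
        gcongr

end OrthoJulia

namespace OrthoJulia

open Filter Complex InnerProductSpace Polynomial

/-! ### Harmonic functions -/

lemma exists_analyticAt_re_of_harmonicAt {h : ℂ → ℝ} {z : ℂ} (hh : HarmonicAt h z) :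
    ∃ F : ℂ → ℂ, AnalyticAt ℂ F z ∧ (fun w => (F w).re) =ᶠ[𝓝 z] h := by
  obtain ⟨ε, hε, hball⟩ := Metric.eventually_nhds_iff_ball.1 hh.eventually
  obtain ⟨F, hF, hFh⟩ := HarmonicOnNhd.exists_analyticOnNhd_ball_re_eq hball
  exact ⟨F, hF z (Metric.mem_ball_self hε),
    eventually_of_mem (Metric.ball_mem_nhds z hε) fun w hw => hFh hw⟩

lemma harmonicAt_comp_of_analyticAt {h : ℂ → ℝ} {f : ℂ → ℂ} {z : ℂ}
    (hh : HarmonicAt h (f z)) (hf : AnalyticAt ℂ f z) : HarmonicAt (fun w => h (f w)) z := by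
  obtain ⟨F, hF, hFh⟩ := exists_analyticAt_re_of_harmonicAt hh
  exact (harmonicAt_congr_nhds (hFh.comp_tendsto hf.continuousAt)).1
    (hF.comp hf).harmonicAt_re

/-- The local maximum principle for harmonic functions: if `h = Re F` near `z`, then `exp F` has a
local maximum of its modulus `exp h`. -/
lemma eventually_eq_of_isLocalMax_of_harmonicAt {h : ℂ → ℝ} {z : ℂ} (hh : HarmonicAt h z)
    (hmax : IsLocalMax h z) : ∀ᶠ w in 𝓝 z, h w = h z := by
  obtain ⟨F, hF, hFh⟩ := exists_analyticAt_re_of_harmonicAt hh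
  have hz : (F z).re = h z := hFh.self_of_nhds
  have hd : ∀ᶠ w in 𝓝 z, DifferentiableAt ℂ (fun w => exp (F w)) w := by
    filter_upwards [hF.eventually_analyticAt] with w hw using hw.differentiableAt.cexp
  have hm : IsLocalMax (norm ∘ fun w => exp (F w)) z := by
    filter_upwards [hmax, hFh] with w hw hw'
    simp only [Function.comp_apply, norm_exp, hz, hw']
    gcongr
  filter_upwards [Complex.eventually_eq_of_isLocalMax_norm hd hm, hFh] with w hw hw'
  rw [← hw', ← hz]
  have := congrArg norm hw
  simpa only [norm_exp, Real.exp_eq_exp] using this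

lemma subharmonicOn_of_harmonicOnNhd {h : ℂ → ℝ} {U : Set ℂ} (hU : IsOpen U)
    (hh : HarmonicOnNhd h U) : SubharmonicOn h U := by
  have hc : ContinuousOn h U := hh.continuousOn
  refine ⟨hc.upperSemicontinuousOn, fun c hcU => ?_⟩
  obtain ⟨ρ, hρ, hball⟩ := Metric.isOpen_iff.1 hU c hcU
  refine ⟨ρ, hρ, fun r hr hrρ => ?_⟩
  have hsub : Metric.closedBall c |r| ⊆ U := by
    rw [abs_of_pos hr]
    exact (Metric.closedBall_subset_ball hrρ).trans hball
  exact ⟨(hc.mono (Metric.sphere_subset_closedBall.trans hsub)).circleIntegrable',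
    (InnerProductSpace.HarmonicOnNhd.circleAverage_eq (hh.mono hsub)).ge⟩

/-! ### Uniqueness of the Green's function -/

section Uniqueness

variable {D : Set ℂ} {g h : ℂ → ℝ}

lemma IsGreenFunction.eq_zero_of_notMem (hg : IsGreenFunction D g)
    (hD : ∀ ζ ∈ frontier D, IsRegularBoundaryPoint D ζ) {z : ℂ} (hz : z ∉ D) : g z = 0 :=
  (hg.eq_zero_iff z).2 ⟨hz, fun hmem => hmem.2 (hD z hmem.1)⟩

/-- Upper semicontinuity makes a Green's function tend to `0` at each of its zeros. -/
lemma IsGreenFunction.continuous (hg : IsGreenFunction D g)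
    (hD : ∀ ζ ∈ frontier D, IsRegularBoundaryPoint D ζ) : Continuous g := by
  refine continuous_iff_continuousAt.2 fun z => ?_
  by_cases hz : z ∈ D
  · exact (hg.harmonic z hz).1.continuousAt
  · have h0 := hg.eq_zero_of_notMem hD hz
    have husc : UpperSemicontinuousAt g z := by
      exact upperSemicontinuousWithinAt_univ_iff.1 (hg.subharmonic.1 z (Set.mem_univ z))
    rw [ContinuousAt, h0]
    refine tendsto_order.2 ⟨fun a ha => .of_forall fun w => ha.trans_le (hg.nonneg w),
      fun a ha => husc a (h0.trans_lt ha)⟩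

lemma IsGreenFunction.tendsto_atTop (hg : IsGreenFunction D g) :
    Tendsto g (Bornology.cobounded ℂ) atTop := by
  obtain ⟨C, hC⟩ := hg.log_asymptotics.bound
  refine tendsto_atTop_mono' _ (f₁ := fun z => Real.log ‖z‖ + -C) ?_
    (tendsto_atTop_add_const_right _ _ (Real.tendsto_log_atTop.comp tendsto_norm_cobounded_atTop))
  filter_upwards [hC] with z hz
  rw [norm_one, mul_one, Real.norm_eq_abs] at hz
  linarith [(abs_le.1 hz).1]

/-- The factor `1 + ε` makes `h - (1 + ε) g` tend to `-∞` at infinity, so that the maximum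
principle applies on the unbounded set `D`. -/
lemma IsGreenFunction.le_one_add_mul (hg : IsGreenFunction D g) (hh : IsGreenFunction D h)
    (hD : ∀ ζ ∈ frontier D, IsRegularBoundaryPoint D ζ) {ε : ℝ} (hε : 0 < ε) (z : ℂ) :
    h z ≤ (1 + ε) * g z := by
  set u : ℂ → ℝ := h - (1 + ε) • g with hu
  have hu_apply : ∀ w, u w = h w - (1 + ε) * g w := fun w => rfl
  have hucont : Continuous u := (hh.continuous hD).sub ((hg.continuous hD).const_smul _)
  have hlim : Tendsto u (Bornology.cobounded ℂ) atBot := by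
    obtain ⟨C, hC⟩ := (hh.log_asymptotics.sub hg.log_asymptotics).bound
    refine tendsto_atBot_mono' _ ?_ (tendsto_atBot_add_const_left _ C
      (tendsto_neg_atTop_atBot.comp (hg.tendsto_atTop.const_mul_atTop hε)))
    filter_upwards [hC] with w hw
    rw [norm_one, mul_one, Real.norm_eq_abs] at hw
    simp only [hu_apply, Function.comp_apply]
    linarith [(abs_le.1 hw).2]
  by_contra! hz
  have hz0 : 0 < u z := by rw [hu_apply]; linarith
  obtain ⟨m, hm⟩ := hucont.exists_forall_ge' z (by
    rw [← Metric.cobounded_eq_cocompact]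
    exact hlim.eventually_le_atBot _)
  have hclopen : IsClopen {w | u w = u m} := by
    refine ⟨isClosed_eq hucont continuous_const, isOpen_iff_mem_nhds.2 fun w hw => ?_⟩
    have hwm : u w = u m := hw
    have hwD : w ∈ D := by
      by_contra hwD
      have : u w = 0 := by
        rw [hu_apply, hh.eq_zero_of_notMem hD hwD, hg.eq_zero_of_notMem hD hwD]; ring
      linarith [hm z]
    have hharm : HarmonicAt u w := (hh.harmonic w hwD).sub (hg.harmonic w hwD).const_smul
    have hloc : IsLocalMax u w := .of_forall fun v => (hm v).trans hwm.ge
    filter_upwards [eventually_eq_of_isLocalMax_of_harmonicAt hharm hloc] with v hv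
      using hv.trans hwm
  have huniv := hclopen.eq_univ ⟨m, rfl⟩
  obtain ⟨w, hw⟩ := (hlim.eventually_lt_atBot 0).exists
  have : u w = u m := by
    have : w ∈ {w | u w = u m} := huniv ▸ Set.mem_univ w
    exact this
  linarith [hm z]

lemma IsGreenFunction.unique (hg : IsGreenFunction D g) (hh : IsGreenFunction D h)
    (hD : ∀ ζ ∈ frontier D, IsRegularBoundaryPoint D ζ) : g = h := by
  have key : ∀ {g h : ℂ → ℝ}, IsGreenFunction D g → IsGreenFunction D h → ∀ z, h z ≤ g z := by
    intro g h hg hh z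
    have hlim : Tendsto (fun ε : ℝ => (1 + ε) * g z) (𝓝[>] 0) (𝓝 (g z)) := by
      have : Continuous fun ε : ℝ => (1 + ε) * g z := by fun_prop
      simpa using (this.tendsto 0).mono_left nhdsWithin_le_nhds
    exact ge_of_tendsto hlim
      (eventually_mem_nhdsWithin.mono fun ε hε => hg.le_one_add_mul hh hD hε z)
  exact funext fun z => le_antisymm (key hh hg z) (key hg hh z)

end Uniqueness

/-! ### The escape rate -/

/-- The escape rate is the uniform limit of `d⁻ᵏ log⁺ ‖f^k‖`: consecutive terms differ by at most
`M d⁻ᵏ`. -/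
lemma exists_escapeRate {f : ℂ → ℂ} (hf : Continuous f) {d M : ℝ} (hd : 2 ≤ d)
    (hM : ∀ z, |Real.posLog ‖f z‖ - d * Real.posLog ‖z‖| ≤ d * M) :
    ∃ g : ℂ → ℝ, Continuous g ∧ (∀ z, g (f z) = d * g z) ∧
      ∀ z, |g z - Real.posLog ‖z‖| ≤ 2 * M := by
  have hd0 : 0 < d := by linarith
  have hM0 : 0 ≤ M := nonneg_of_mul_nonneg_right ((abs_nonneg _).trans (hM 0)) hd0
  have hde : d * d⁻¹ = 1 := mul_inv_cancel₀ hd0.ne'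
  have hr : d⁻¹ < 1 := inv_lt_one_of_one_lt₀ (by linarith)
  have hr2 : d⁻¹ ≤ 2⁻¹ := inv_anti₀ (by norm_num) hd
  let φ : ℂ → ℕ → ℝ := fun z k => d⁻¹ ^ k * Real.posLog ‖f^[k] z‖
  have hφ : ∀ z k, dist (φ z k) (φ z (k + 1)) ≤ M * d⁻¹ ^ k := by
    intro z k
    have h1 : φ z k - φ z (k + 1) = -(d⁻¹ ^ (k + 1) *
        (Real.posLog ‖f (f^[k] z)‖ - d * Real.posLog ‖f^[k] z‖)) := by
      simp only [φ, Function.iterate_succ_apply']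
      linear_combination (-(d⁻¹ ^ k * Real.posLog ‖f^[k] z‖)) * hde
    rw [Real.dist_eq, h1, abs_neg, abs_mul, abs_of_nonneg (by positivity)]
    calc d⁻¹ ^ (k + 1) * |Real.posLog ‖f (f^[k] z)‖ - d * Real.posLog ‖f^[k] z‖|
        ≤ d⁻¹ ^ (k + 1) * (d * M) := by gcongr; exact hM _
      _ = M * d⁻¹ ^ k := by linear_combination (M * d⁻¹ ^ k) * hde
  choose g hg using fun z => cauchySeq_tendsto_of_complete (cauchySeq_of_le_geometric _ M hr (hφ z))
  have hdist : ∀ z k, dist (φ z k) (g z) ≤ 2 * M * d⁻¹ ^ k := by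
    intro z k
    refine (dist_le_of_le_geometric_of_tendsto _ M hr (hφ z) (hg z) k).trans ?_
    rw [div_le_iff₀ (by linarith)]
    have : 0 ≤ M * d⁻¹ ^ k := by positivity
    nlinarith
  refine ⟨g, ?_, fun z => ?_, fun z => ?_⟩
  · have hunif : TendstoUniformly (fun k z => φ z k) g atTop := by
      rw [Metric.tendstoUniformly_iff]
      intro ε hε
      have : Tendsto (fun k : ℕ => 2 * M * d⁻¹ ^ k) atTop (𝓝 0) := by
        simpa using (tendsto_pow_atTop_nhds_zero_of_lt_one (by positivity) hr).const_mul (2 * M)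
      filter_upwards [this.eventually_lt_const hε] with k hk z
      rw [dist_comm]
      exact (hdist z k).trans_lt hk
    refine hunif.continuous (.of_forall fun k => ?_)
    exact continuous_const.mul (Real.continuous_posLog.comp (hf.iterate k).norm)
  · refine tendsto_nhds_unique (hg (f z)) ?_
    refine (((hg z).comp (tendsto_add_atTop_nat 1)).const_mul d).congr fun k => ?_
    simp only [φ, Function.comp_apply, Function.iterate_succ_apply]
    linear_combination (d⁻¹ ^ k * Real.posLog ‖f^[k] (f z)‖) * hde
  · have := hdist z 0
    simpa [φ, Real.dist_eq, abs_sub_comm] using this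

section EscapeRate

variable {P : ℂ[X]} {g : ℂ → ℝ} {M : ℝ}

lemma escapeRate_iterate (hgP : ∀ z, g (P.eval z) = P.natDegree * g z) (k : ℕ) (z : ℂ) :
    g ((fun w => P.eval w)^[k] z) = (P.natDegree : ℝ) ^ k * g z := by
  induction k with
  | zero => simp
  | succ k ih => rw [Function.iterate_succ_apply', hgP, ih]; ring

lemma tendsto_escapeRate_cobounded (hgM : ∀ z, |g z - Real.posLog ‖z‖| ≤ 2 * M) :
    Tendsto g (Bornology.cobounded ℂ) atTop := by
  refine tendsto_atTop_mono (f := fun z => Real.log ‖z‖ + -(2 * M)) (fun z => ?_)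
    (tendsto_atTop_add_const_right _ _ (Real.tendsto_log_atTop.comp tendsto_norm_cobounded_atTop))
  have : Real.log ‖z‖ ≤ Real.posLog ‖z‖ := le_max_right _ _
  linarith [(abs_le.1 (hgM z)).1]

lemma tendsto_cobounded_of_tendsto_escapeRate {ι : Type*} {l : Filter ι} {f : ι → ℂ}
    (hgM : ∀ z, |g z - Real.posLog ‖z‖| ≤ 2 * M) (h : Tendsto (fun i => g (f i)) l atTop) :
    Tendsto f l (Bornology.cobounded ℂ) := by
  rw [← tendsto_norm_atTop_iff_cobounded]
  refine tendsto_atTop.2 fun b => ?_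
  filter_upwards [h.eventually_gt_atTop (Real.posLog b + 2 * M)] with i hi
  by_contra! hlt
  have := Real.posLog_le_posLog (norm_nonneg (f i)) hlt.le
  linarith [(abs_le.1 (hgM (f i))).2]

lemma escapeRate_nonneg (hd : 2 ≤ P.natDegree) (hgP : ∀ z, g (P.eval z) = P.natDegree * g z)
    (hgM : ∀ z, |g z - Real.posLog ‖z‖| ≤ 2 * M) (z : ℂ) : 0 ≤ g z := by
  by_contra! hz
  -- otherwise `g` would tend to `-∞` along the orbit of `z`, but `g` is bounded below
  have hd1 : (1 : ℝ) < P.natDegree := by exact_mod_cast hd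
  have h := (tendsto_pow_atTop_atTop_of_one_lt hd1).atTop_mul_const_of_neg hz
  obtain ⟨k, hk⟩ := (h.eventually_lt_atBot (-(2 * M))).exists
  rw [← escapeRate_iterate hgP] at hk
  set w := (fun w => P.eval w)^[k] z
  have : 0 ≤ Real.posLog ‖w‖ := Real.posLog_nonneg
  linarith [(abs_le.1 (hgM w)).1]

lemma basinOfInfinity_eq_setOf_escapeRate_pos (hd : 2 ≤ P.natDegree)
    (hgP : ∀ z, g (P.eval z) = P.natDegree * g z)
    (hgM : ∀ z, |g z - Real.posLog ‖z‖| ≤ 2 * M) : basinOfInfinity P = {z | 0 < g z} := by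
  ext z
  constructor
  · intro hz
    refine (escapeRate_nonneg hd hgP hgM z).lt_of_ne fun h0 => ?_
    obtain ⟨k, hk⟩ := (((tendsto_escapeRate_cobounded hgM).comp hz).eventually_gt_atTop 0).exists
    simp [escapeRate_iterate hgP, ← h0] at hk
  · intro hz
    refine tendsto_cobounded_of_tendsto_escapeRate hgM ?_
    simp_rw [escapeRate_iterate hgP]
    exact (tendsto_pow_atTop_atTop_of_one_lt (by exact_mod_cast hd)).atTop_mul_const hz

lemma tendsto_eval_div_leadingCoeff_mul_pow (hP : P ≠ 0) :
    Tendsto (fun z => P.eval z / (P.leadingCoeff * z ^ P.natDegree)) (Bornology.cobounded ℂ)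
      (𝓝 1) := by
  have hlead : P.leadingCoeff ≠ 0 := leadingCoeff_ne_zero.2 hP
  have h : Tendsto (fun z : ℂ => P.reverse.eval z⁻¹ / P.leadingCoeff) (Bornology.cobounded ℂ)
      (𝓝 1) := by
    have h1 := (P.reverse.continuous.tendsto 0).comp (tendsto_inv₀_cobounded (α := ℂ))
    rw [← coeff_zero_eq_eval_zero, coeff_zero_reverse] at h1
    simpa [hlead] using h1.div_const P.leadingCoeff
  refine h.congr' ?_
  filter_upwards [Bornology.eventually_ne_cobounded (0 : ℂ)] with z hz
  let _ : Invertible z := invertibleOfNonzero hz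
  have h2 := eval₂_reverse_mul_pow (RingHom.id ℂ) z P
  rw [invOf_eq_inv] at h2
  simp only [eval₂_id] at h2
  rw [← h2, mul_div_mul_right _ _ (pow_ne_zero _ hz)]

/-- Near infinity `g(z) = log ‖z‖ + Re F(z)`, where
`F(z) = ∑ d^(-k-1) (log ‖γ‖ + Log (P(w) / (γ w^d)))` with `w = P^k(z)`, `d` the degree and `γ` the
leading coefficient of `P`, is holomorphic. The superlevel sets of `g` serve as neighbourhoods of
infinity because `P` maps each of them into itself. -/
lemma exists_harmonicAt_escapeRate_of_lt (hd : 2 ≤ P.natDegree) (hgc : Continuous g)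
    (hgP : ∀ z, g (P.eval z) = P.natDegree * g z)
    (hgM : ∀ z, |g z - Real.posLog ‖z‖| ≤ 2 * M) :
    ∃ s : ℝ, ∀ z, s < g z → HarmonicAt g z := by
  have hP0 : P ≠ 0 := by rintro rfl; simp at hd
  have hγ : P.leadingCoeff ≠ 0 := leadingCoeff_ne_zero.2 hP0
  have hd2 : (2 : ℝ) ≤ P.natDegree := by exact_mod_cast hd
  set d : ℝ := (P.natDegree : ℝ)
  have hd0 : 0 < d := by linarith
  have hde : d * d⁻¹ = 1 := mul_inv_cancel₀ hd0.ne'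
  have hr : d⁻¹ < 1 := inv_lt_one_of_one_lt₀ (by linarith)
  set q : ℂ → ℂ := fun z => P.eval z / (P.leadingCoeff * z ^ P.natDegree) with hq
  have hq1 := tendsto_eval_div_leadingCoeff_mul_pow hP0
  have hev : ∀ᶠ z in Bornology.cobounded ℂ, q z ∈ slitPlane ∧ ‖log (q z)‖ < 1 ∧ 1 < ‖z‖ := by
    refine (hq1.eventually (isOpen_slitPlane.mem_nhds one_mem_slitPlane)).and
      (.and ?_ (tendsto_norm_cobounded_atTop.eventually_gt_atTop 1))
    have : Tendsto (fun z => ‖log (q z)‖) (Bornology.cobounded ℂ) (𝓝 0) := by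
      simpa using ((continuousAt_clog one_mem_slitPlane).tendsto.comp hq1).norm
    exact this.eventually_lt_const one_pos
  obtain ⟨s, hs0, hs⟩ : ∃ s : ℝ, 0 ≤ s ∧ ∀ z, s < g z →
      q z ∈ slitPlane ∧ ‖log (q z)‖ < 1 ∧ 1 < ‖z‖ := by
    have h1 : Tendsto id (comap g atTop) (Bornology.cobounded ℂ) :=
      tendsto_cobounded_of_tendsto_escapeRate hgM tendsto_comap
    obtain ⟨t, ht, hts⟩ := mem_comap.1 (h1.eventually hev)
    obtain ⟨a, ha⟩ := mem_atTop_sets.1 ht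
    exact ⟨max a 0, le_max_right _ _, fun z hz => hts (ha _ ((le_max_left _ _).trans hz.le))⟩
  set V : Set ℂ := {z | s < g z} with hV
  have hVo : IsOpen V := isOpen_lt continuous_const hgc
  have hVP : ∀ z ∈ V, P.eval z ∈ V := by
    intro z hz
    have hz' : s < g z := hz
    change s < g (P.eval z)
    rw [hgP]
    nlinarith
  have hVk : ∀ k, ∀ z ∈ V, (fun w => P.eval w)^[k] z ∈ V := by
    intro k
    induction k with
    | zero => exact fun z hz => hz
    | succ k ih => exact fun z hz => ih _ (hVP z hz)
  have hdiffk : ∀ k, Differentiable ℂ (fun w => P.eval w)^[k] := fun k =>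
    P.differentiable.iterate k
  set L : ℂ → ℂ := fun z => (Real.log ‖P.leadingCoeff‖ : ℂ) + log (q z) with hL
  have hLd : DifferentiableOn ℂ L V := by
    intro z hz
    have hz0 : z ≠ 0 := norm_pos_iff.1 (one_pos.trans (hs z hz).2.2)
    have hqd : DifferentiableAt ℂ q z := by
      refine P.differentiable.differentiableAt.div (by fun_prop) ?_
      exact mul_ne_zero hγ (pow_ne_zero _ hz0)
    exact ((differentiableAt_const _).add (hqd.clog (hs z hz).1)).differentiableWithinAt
  have hLre : ∀ z ∈ V, (L z).re = Real.log ‖P.eval z‖ - d * Real.log ‖z‖ := by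
    intro z hz
    have hz0 : ‖z‖ ≠ 0 := (one_pos.trans (hs z hz).2.2).ne'
    have hPz : ‖P.eval z‖ ≠ 0 := (one_pos.trans (hs _ (hVP z hz)).2.2).ne'
    have hγ' : ‖P.leadingCoeff‖ ≠ 0 := norm_ne_zero_iff.2 hγ
    simp only [hL, hq, add_re, ofReal_re, log_re, norm_div, norm_mul, norm_pow]
    rw [Real.log_div hPz (mul_ne_zero hγ' (pow_ne_zero _ hz0)),
      Real.log_mul hγ' (pow_ne_zero _ hz0), Real.log_pow]
    ring
  set B : ℝ := |Real.log ‖P.leadingCoeff‖| + 1 with hB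
  have hLb : ∀ z ∈ V, ‖L z‖ ≤ B := by
    intro z hz
    refine (norm_add_le _ _).trans (add_le_add ?_ (hs z hz).2.1.le)
    rw [norm_real, Real.norm_eq_abs]
  set T : ℕ → ℂ → ℂ := fun k z => ((d⁻¹ ^ (k + 1) : ℝ) : ℂ) * L ((fun w => P.eval w)^[k] z) with hT
  have hTb : ∀ k, ∀ z ∈ V, ‖T k z‖ ≤ d⁻¹ ^ (k + 1) * B := by
    intro k z hz
    simp only [hT, norm_mul, norm_real]
    rw [Real.norm_of_nonneg (by positivity)]
    gcongr
    exact hLb _ (hVk k z hz)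
  have hsum : Summable fun k : ℕ => d⁻¹ ^ (k + 1) * B :=
    ((summable_nat_add_iff 1).2 (summable_geometric_of_lt_one (by positivity) hr)).mul_right B
  have hFd : DifferentiableOn ℂ (fun z => ∑' k, T k z) V := by
    refine differentiableOn_tsum_of_summable_norm hsum (fun k => ?_) hVo hTb
    exact (hLd.comp (hdiffk k).differentiableOn (hVk k)).const_mul _
  have hbdd : ∀ z ∈ V, |g z - Real.log ‖z‖| ≤ 2 * M := by
    intro z hz
    rw [← Real.posLog_eq_log (by rw [abs_norm]; exact (hs z hz).2.2.le)]
    exact hgM z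
  -- the partial sums telescope, with a remainder that is bounded by `2 * M * d⁻¹ ^ K`
  have hpartial : ∀ z ∈ V, ∀ K : ℕ, g z - Real.log ‖z‖ - ∑ k ∈ Finset.range K, (T k z).re =
      d⁻¹ ^ K * (g ((fun w => P.eval w)^[K] z) - Real.log ‖(fun w => P.eval w)^[K] z‖) := by
    intro z hz K
    induction K with
    | zero => simp
    | succ K ih =>
      rw [Finset.sum_range_succ, ← sub_sub, ih, Function.iterate_succ_apply']
      simp only [hT, re_ofReal_mul]
      rw [hLre _ (hVk K z hz), hgP]
      set w := (fun w => P.eval w)^[K] z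
      linear_combination (-(d⁻¹ ^ K * (g w - Real.log ‖w‖))) * hde
  have hgF : ∀ z ∈ V, g z = Real.log ‖z‖ + (∑' k, T k z).re := by
    intro z hz
    have hS : Summable fun k => T k z := .of_norm_bounded hsum fun k => hTb k z hz
    have h1 := (hasSum_re hS.hasSum).tendsto_sum_nat
    have h2 : Tendsto (fun K : ℕ => g z - Real.log ‖z‖ - ∑ k ∈ Finset.range K, (T k z).re)
        atTop (𝓝 0) := by
      refine squeeze_zero_norm (a := fun K : ℕ => d⁻¹ ^ K * (2 * M)) (fun K => ?_) ?_
      · rw [hpartial z hz K, norm_mul, Real.norm_of_nonneg (by positivity), Real.norm_eq_abs]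
        gcongr
        exact hbdd _ (hVk K z hz)
      · simpa using (tendsto_pow_atTop_nhds_zero_of_lt_one (by positivity) hr).mul_const (2 * M)
    have h3 := tendsto_nhds_unique h2 (h1.const_sub (g z - Real.log ‖z‖))
    linarith
  refine ⟨s, fun z hz => ?_⟩
  have hzV : V ∈ 𝓝 z := hVo.mem_nhds hz
  have hz0 : z ≠ 0 := norm_pos_iff.1 (one_pos.trans (hs z hz).2.2)
  have hharm : HarmonicAt ((fun w => Real.log ‖w‖) + fun w => (∑' k, T k w).re) z :=
    (analyticAt_id.harmonicAt_log_norm hz0).add (hFd.analyticAt hzV).harmonicAt_re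
  exact (harmonicAt_congr_nhds (eventually_of_mem hzV fun w hw => hgF w hw)).2 hharm

/-- Harmonicity spreads from a neighbourhood of infinity to `{g > 0}` by `g = d⁻ᵏ g ∘ P^k`. -/
lemma harmonicOnNhd_escapeRate (hd : 2 ≤ P.natDegree) (hgc : Continuous g)
    (hgP : ∀ z, g (P.eval z) = P.natDegree * g z)
    (hgM : ∀ z, |g z - Real.posLog ‖z‖| ≤ 2 * M) : HarmonicOnNhd g {z | 0 < g z} := by
  intro z hz
  obtain ⟨s, hs⟩ := exists_harmonicAt_escapeRate_of_lt hd hgc hgP hgM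
  have hd1 : (1 : ℝ) < P.natDegree := by exact_mod_cast hd
  obtain ⟨k, hk⟩ := (((tendsto_pow_atTop_atTop_of_one_lt hd1).atTop_mul_const
    (show 0 < g z from hz)).eventually_gt_atTop s).exists
  rw [← escapeRate_iterate hgP] at hk
  have han : AnalyticAt ℂ (fun w => P.eval w)^[k] z :=
    (P.differentiable.iterate k).analyticAt z
  have h := (harmonicAt_comp_of_analyticAt (hs _ hk) han).const_smul
    (c := ((P.natDegree : ℝ) ^ k)⁻¹)
  convert h using 1
  funext w
  simp only [Pi.smul_apply, smul_eq_mul, escapeRate_iterate hgP]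
  field_simp

lemma isRegularBoundaryPoint_of_harmonicOnNhd (hg0 : ∀ z, 0 ≤ g z) (hgc : Continuous g)
    (hharm : HarmonicOnNhd g {z | 0 < g z}) {ζ : ℂ} (hζ : ζ ∈ frontier {z | 0 < g z}) :
    IsRegularBoundaryPoint {z | 0 < g z} ζ := by
  have hopen : IsOpen {z | 0 < g z} := isOpen_lt continuous_const hgc
  have hζ0 : g ζ = 0 := by
    rw [hopen.frontier_eq] at hζ
    exact le_antisymm (not_lt.1 hζ.2) (hg0 ζ)
  refine ⟨hζ, Set.univ, -g, isOpen_univ, Set.mem_univ _, ?_, fun z hz => ?_, ?_⟩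
  · rw [Set.inter_univ]
    exact subharmonicOn_of_harmonicOnNhd hopen hharm.neg
  · exact neg_neg_of_pos hz.1
  · have : Tendsto (-g) (𝓝 ζ) (𝓝 0) := by simpa [hζ0] using (hgc.neg).tendsto ζ
    exact this.mono_left nhdsWithin_le_nhds

lemma isGreenFunction_escapeRate (hg0 : ∀ z, 0 ≤ g z) (hgc : Continuous g)
    (hharm : HarmonicOnNhd g {z | 0 < g z})
    (hgM : ∀ z, |g z - Real.posLog ‖z‖| ≤ 2 * M) : IsGreenFunction {z | 0 < g z} g where
  nonneg := hg0
  subharmonic := by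
    refine ⟨hgc.upperSemicontinuous.upperSemicontinuousOn _, fun c _ => ?_⟩
    by_cases hc : 0 < g c
    · exact (subharmonicOn_of_harmonicOnNhd (isOpen_lt continuous_const hgc) hharm).2 c hc
    · refine ⟨1, one_pos, fun r _ _ => ⟨hgc.continuousOn.circleIntegrable', (not_lt.1 hc).trans ?_⟩⟩
      exact Real.circleAverage_nonneg_of_nonneg fun z _ => hg0 z
  harmonic := hharm
  pos := fun z hz => hz
  eq_zero_iff := by
    refine fun z => ⟨fun hz => ⟨fun h => (show 0 < g z from h).ne' hz, fun h => ?_⟩, fun hz => ?_⟩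
    · exact h.2 (isRegularBoundaryPoint_of_harmonicOnNhd hg0 hgc hharm h.1)
    · exact le_antisymm (not_lt.1 hz.1) (hg0 z)
  log_asymptotics := by
    refine .of_bound (2 * M) ?_
    filter_upwards [tendsto_norm_cobounded_atTop.eventually_ge_atTop 1] with z hz
    rw [← Real.posLog_eq_log (by rwa [abs_norm]), norm_one, mul_one]
    exact hgM z

/-- The heart of the estimate: if `log⁺ ‖P‖` is within `d M` of `d log⁺ ‖·‖`, then the Green's
function `g` is within `2 M` of `log⁺ ‖·‖`, and `g ∘ P = d g` improves this by a factor `d`. -/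
theorem greenFunction_basinOfInfinity (hd : 2 ≤ P.natDegree)
    (hM : ∀ z, |Real.posLog ‖P.eval z‖ - P.natDegree * Real.posLog ‖z‖| ≤ P.natDegree * M) :
    (∃ g : ℂ → ℝ, IsGreenFunction (basinOfInfinity P) g) ∧
      ∀ g : ℂ → ℝ, IsGreenFunction (basinOfInfinity P) g →
        ∀ z, |g z - 1 / (P.natDegree : ℝ) * Real.posLog ‖P.eval z‖| ≤ 2 * M / P.natDegree := by
  have hd2 : (2 : ℝ) ≤ P.natDegree := by exact_mod_cast hd
  obtain ⟨g, hgc, hgP, hgM⟩ := exists_escapeRate P.continuous hd2 hM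
  have hg0 := escapeRate_nonneg hd hgP hgM
  have hharm := harmonicOnNhd_escapeRate hd hgc hgP hgM
  rw [basinOfInfinity_eq_setOf_escapeRate_pos hd hgP hgM]
  have hG := isGreenFunction_escapeRate hg0 hgc hharm hgM
  refine ⟨⟨g, hG⟩, fun h hh z => ?_⟩
  have hgh : g = h := hG.unique hh fun ζ hζ =>
    isRegularBoundaryPoint_of_harmonicOnNhd hg0 hgc hharm hζ
  rw [← hgh]
  have hd0 : (0 : ℝ) < P.natDegree := by linarith
  have h1 : g z - 1 / (P.natDegree : ℝ) * Real.posLog ‖P.eval z‖ =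
      (g (P.eval z) - Real.posLog ‖P.eval z‖) / P.natDegree := by
    rw [hgP]; field_simp
  rw [h1, abs_div, abs_of_pos hd0]
  gcongr
  exact hgM _

end EscapeRate

end OrthoJulia

/-! ### The uniform estimate for orthonormal polynomials -/

namespace OrthoJulia

open Filter MeasureTheory Polynomial

lemma ClassB.exists_ae_norm_le {μ : Measure ℂ} (hμ : ClassB μ) :
    ∃ R : ℝ, 0 < R ∧ ∀ᵐ z ∂μ, ‖z‖ ≤ R := by
  obtain ⟨R, hR0, hR⟩ := hμ.isCompact_support.isBounded.exists_pos_norm_le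
  exact ⟨R, hR0, mem_of_superset Measure.support_mem_ae hR⟩

lemma ClassBPlus.exists_abs_posLog_sub_le {μ : Measure ℂ} (hμ : ClassBPlus μ) {P : ℕ → ℂ[X]}
    (hP : IsOrthonormalPolynomials μ P) :
    ∃ M : ℝ, 0 < M ∧ ∀ᶠ n : ℕ in atTop, ∀ z,
      |Real.posLog ‖(P n).eval z‖ - n * Real.posLog ‖z‖| ≤ n * M := by
  obtain ⟨hB, P', hP', hlimsup⟩ := hμ
  have := hB.isProbabilityMeasure
  obtain ⟨R, hR0, hR⟩ := hB.exists_ae_norm_le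
  obtain ⟨C, hC⟩ :=
    eventually_le_pow_of_limsup_lt_top (fun n => (hP'.leadingCoeff_re_pos n).le) hlimsup
  have hM : 0 < Real.posLog C + Real.log 2 + Real.posLog R + Real.posLog (2 * R) := by
    have h1 : 0 ≤ Real.posLog C := Real.posLog_nonneg
    have h2 : 0 ≤ Real.posLog R := Real.posLog_nonneg
    have h3 : 0 ≤ Real.posLog (2 * R) := Real.posLog_nonneg
    have h4 : 0 < Real.log 2 := Real.log_pos (by norm_num)
    positivity
  refine ⟨_, hM, ?_⟩
  filter_upwards [hC] with n hn z
  have hup : ‖(P n).leadingCoeff‖ ≤ C ^ (P n).natDegree := by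
    rw [hP.norm_leadingCoeff, hP.natDegree_eq]
    exact (hP'.leadingCoeff_re_le hP hR n).trans hn
  have hlow : 1 ≤ ‖(P n).leadingCoeff‖ * R ^ (P n).natDegree := by
    rw [hP.norm_leadingCoeff, hP.natDegree_eq]
    exact hP.one_le_leadingCoeff_mul_pow hR0.le hR n
  have h := abs_posLog_norm_eval_sub_le hR0 (fun a ha => hP.norm_le_of_isRoot hR ha) hlow hup z
  rwa [hP.natDegree_eq] at h

end OrthoJulia

theorem proposition2p3 (μ : MeasureTheory.Measure ℂ) (hμ : OrthoJulia.ClassBPlus μ)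
    (P : ℕ → Polynomial ℂ) (hP : OrthoJulia.IsOrthonormalPolynomials μ P) :
    ∃ (N : ℕ) (M : ℝ), 0 < M ∧ ∀ n ≥ N,
      (∃ g : ℂ → ℝ, OrthoJulia.IsGreenFunction (OrthoJulia.basinOfInfinity (P n)) g) ∧
      ∀ g : ℂ → ℝ, OrthoJulia.IsGreenFunction (OrthoJulia.basinOfInfinity (P n)) g →
        ∀ z : ℂ, |g z - 1 / (n : ℝ) * Real.posLog ‖(P n).eval z‖| ≤ M / (n : ℝ) := by
  obtain ⟨M, hM0, hM⟩ := hμ.exists_abs_posLog_sub_le hP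
  obtain ⟨N, hN⟩ := Filter.eventually_atTop.1 hM
  refine ⟨max N 2, 2 * M, by positivity, fun n hn => ?_⟩
  have hdeg := hP.natDegree_eq n
  have h := OrthoJulia.greenFunction_basinOfInfinity (P := P n) (M := M)
    (by rw [hdeg]; exact (le_max_right _ _).trans hn)
    (by rw [hdeg]; exact hN n ((le_max_left _ _).trans hn))
  rwa [hdeg] at h
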